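/- For $z\in\mathbb C$ let $(z)_n=z(z+1)\cdots(z+n-1)$. For complex parameters with $\operatorname{Re}\varkappa,\operatorname{Re}\varrho,\operatorname{Re}\Upsilon>0$ let $$E_{\varkappa,\varrho,\Upsilon}^{(\gamma_1;\gamma_2;\gamma_3;\gamma_4)}(x,y)=\sum_{s=0}^\infty\sum_{r=0}^\infty\frac{(\gamma_1)_{2s}(\gamma_2)_{s+r}\,x^s y^{\Upsilon r}}{(\gamma_3)_s(\gamma_4)_s\,\Gamma(\varkappa+s)\Gamma(\varrho+\Upsilon r)\,r!\,s!}$$ be the modified bivariate Hermite–Konhauser Mittag-Leffler function (powers are principal). When $\gamma_3=\frac{\gamma_1+1}2$ and $\gamma_4=\gamma_2$, the quotients $(\gamma_1)_{2s}/(\gamma_3)_s$ and $(\gamma_2)_{s+r}/(\gamma_4)_s$ are, at the zeros of their denominators, given the values $4^s(\gamma_1/2)_s$ and $(\gamma_2+s)_r$ of their continuous extensions in $\gamma_1$ and $\gamma_2$. For $\nu_1,\nu_2\in\mathbb C$ and real $A<B$, $C<D$ put, for $X>A$, $Y>C$, $$\bigl({}_{A^+,C^+}\mathbb I_{\varkappa,\varrho,\Upsilon,\nu_1,\nu_2}^{(\gamma_1;\gamma_2;\gamma_3;\gamma_4)}\psi\bigr)(X,Y)=\int_C^Y\!\!\int_A^X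 (X-t)^{\varkappa-1}(Y-\Omega)^{\varrho-1}E_{\varkappa,\varrho,\Upsilon}^{(\gamma_1;\gamma_2;\gamma_3;\gamma_4)}\bigl(\nu_1(X-t),\nu_2(Y-\Omega)\bigr)\psi(t,\Omega)\,dt\,d\Omega .$$ Let $\varkappa,\varrho,\sigma,\eta,\Upsilon\in\mathbb C$ have positive real parts, let $\nu_1,\nu_2,\gamma_1,\gamma_2,\mu_1,\mu_2\in\mathbb C$, and let $\psi\in L_1((A,B)\times(C,D))$. Then the series of $E_{\varkappa,\varrho,\Upsilon}^{(\gamma_1;\gamma_2;\frac{\gamma_1+1}2;\gamma_2)}$ converges absolutely everywhere, the integral defining $\mathbb I_{\varkappa,\varrho,\Upsilon,\nu_1,\nu_2}^{(\gamma_1;\gamma_2;\frac{\gamma_1+1}2;\gamma_2)}\psi$ converges absolutely at almost every point of $(A,B)\times(C,D)$ and belongs to $L_1((A,B)\times(C,D))$, and, almost everywhere on $(A,B)\times(C,D)$ (that is, as elements of $L_1$), $${}_{A^+,C^+}\mathbb I_{\varkappa,\varrho,\Upsilon,\nu_1,\nu_2}^{(\gamma_1;\gamma_2;\frac{\gamma_1+1}2;\gamma_2)}\;{}_{A^+,C^+}\mathbb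 I_{\sigma,\eta,\Upsilon,\nu_1,\nu_2}^{(\mu_1;\mu_2;\frac{\mu_1+1}2;\mu_2)}\psi={}_{A^+,C^+}\mathbb I_{\varkappa+\sigma,\varrho+\eta,\Upsilon,\nu_1,\nu_2}^{(\gamma_1+\mu_1;\gamma_2+\mu_2;\frac{\gamma_1+\mu_1+1}2;\gamma_2+\mu_2)}\psi .$$ In particular, almost everywhere on $(A,B)\times(C,D)$, $${}_{A^+,C^+}\mathbb I_{\varkappa,\varrho,\Upsilon,\nu_1,\nu_2}^{(\gamma_1;\gamma_2;\frac{\gamma_1+1}2;\gamma_2)}\;{}_{A^+,C^+}\mathbb I_{\sigma,\eta,\Upsilon,\nu_1,\nu_2}^{(-\gamma_1;-\gamma_2;\frac{-\gamma_1+1}2;-\gamma_2)}\psi={}_{A^+,C^+}\mathbb I_{\varkappa+\sigma,\varrho+\eta,\Upsilon,\nu_1,\nu_2}^{(0;0;\frac12;0)}\psi={}_YI_{C^+}^{\varrho+\eta}\,{}_XI_{A^+}^{\varkappa+\sigma}\psi ,$$ where $$\bigl({}_YI_{C^+}^{\beta}\,{}_XI_{A^+}^{\alpha}\psi\bigr)(X,Y)=\frac1{\Gamma(\beta)\Gamma(\alpha)}\int_C^Y\!\!\int_A^X(X-t)^{\alpha-1}(Y-\Omega)^{\beta-1}\psi(t,\Omega)\,dt\,d\Omega$$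 is the double Riemann–Liouville fractional integral. -/

import Mathlib

open MeasureTheory

noncomputable section

/-- The Pochhammer symbol `(z)_n = z (z + 1) ⋯ (z + n - 1)`. -/
def poch (z : ℂ) (n : ℕ) : ℂ := (ascPochhammer ℂ n).eval z

open Classical in
/-- The quotient `(γ₁)_{2s} / (γ₃)_s`. It is the literal quotient whenever `(γ₃)_s ≠ 0`. On the
family `γ₃ = (γ₁ + 1) / 2` the zeros of the denominator are removable singularities, and there the
quotient is given the value of its continuous extension in `γ₁`, namely `4 ^ s (γ₁ / 2)_s`
(see `continuous_hkQuotX`). -/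
def hkQuotX (γ₁ γ₃ : ℂ) (s : ℕ) : ℂ :=
  if poch γ₃ s = 0 ∧ γ₃ = (γ₁ + 1) / 2 then 4 ^ s * poch (γ₁ / 2) s
  else poch γ₁ (2 * s) / poch γ₃ s

open Classical in
/-- The quotient `(γ₂)_{s+r} / (γ₄)_s`. It is the literal quotient whenever `(γ₄)_s ≠ 0`. On the
family `γ₄ = γ₂` the zeros of the denominator are removable singularities, and there the quotient
is given the value of its continuous extension in `γ₂`, namely `(γ₂ + s)_r`
(see `continuous_hkQuotY`). -/
def hkQuotY (γ₂ γ₄ : ℂ) (s r : ℕ) : ℂ :=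
  if poch γ₄ s = 0 ∧ γ₄ = γ₂ then poch (γ₂ + s) r
  else poch γ₂ (s + r) / poch γ₄ s

theorem poch_zero (z : ℂ) : poch z 0 = 1 := by simp [poch]

theorem poch_succ (z : ℂ) (n : ℕ) : poch z (n + 1) = poch z n * (z + n) := by
  simp [poch, ascPochhammer_succ_eval]

theorem poch_two_mul (z : ℂ) (s : ℕ) :
    poch z (2 * s) = 4 ^ s * poch (z / 2) s * poch ((z + 1) / 2) s := by
  induction s with
  | zero => simp [poch_zero]
  | succ s ih =>
    rw [show 2 * (s + 1) = 2 * s + 1 + 1 by ring, poch_succ, poch_succ, poch_succ, poch_succ, ih]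
    push_cast
    ring

theorem poch_add (z : ℂ) (s r : ℕ) : poch z (s + r) = poch z s * poch (z + s) r := by
  induction r with
  | zero => simp [poch_zero]
  | succ r ih =>
    rw [← Nat.add_assoc, poch_succ, poch_succ, ih]
    push_cast
    ring

theorem continuous_poch (n : ℕ) : Continuous fun z : ℂ => poch z n :=
  (ascPochhammer ℂ n).continuous

/-- Along the family `γ₃ = (γ₁ + 1) / 2` the quotient is continuous, with no exceptional `γ₁`. -/
theorem continuous_hkQuotX (s : ℕ) : Continuous fun γ₁ : ℂ => hkQuotX γ₁ ((γ₁ + 1) / 2) s := by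
  have h : (fun γ₁ : ℂ => hkQuotX γ₁ ((γ₁ + 1) / 2) s) = fun γ₁ => 4 ^ s * poch (γ₁ / 2) s := by
    funext γ₁
    by_cases h0 : poch ((γ₁ + 1) / 2) s = 0
    · simp [hkQuotX, h0]
    · simp only [hkQuotX, h0, false_and, if_false]
      rw [poch_two_mul, mul_div_cancel_right₀ _ h0]
  rw [h]
  exact continuous_const.mul ((continuous_poch s).comp (continuous_id.div_const 2))

/-- Along the family `γ₄ = γ₂` the quotient is continuous, with no exceptional `γ₂`. -/
theorem continuous_hkQuotY (s r : ℕ) : Continuous fun γ₂ : ℂ => hkQuotY γ₂ γ₂ s r := by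
  have h : (fun γ₂ : ℂ => hkQuotY γ₂ γ₂ s r) = fun γ₂ => poch (γ₂ + s) r := by
    funext γ₂
    by_cases h0 : poch γ₂ s = 0
    · simp [hkQuotY, h0]
    · simp only [hkQuotY, h0, false_and, if_false]
      rw [poch_add, mul_div_cancel_left₀ _ h0]
  rw [h]
  exact (continuous_poch r).comp (continuous_id.add continuous_const)

/-- The general term of the modified bivariate H-K Mittag-Leffler series,
`(γ₁)_{2s} (γ₂)_{s+r} x^s y^{Υ r} / ((γ₃)_s (γ₄)_s Γ(κ + s) Γ(ρ + Υ r) r! s!)`, where the power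
`y^{Υ r}` is the principal one. -/
def hkTerm (κ ρ Υ γ₁ γ₂ γ₃ γ₄ x y : ℂ) (s r : ℕ) : ℂ :=
  hkQuotX γ₁ γ₃ s * hkQuotY γ₂ γ₄ s r * x ^ s * y ^ (Υ * (r : ℂ)) /
    (Complex.Gamma (κ + s) * Complex.Gamma (ρ + Υ * r) * (r.factorial : ℂ) * (s.factorial : ℂ))

/-- The modified bivariate H-K Mittag-Leffler function
`E_{κ,ρ,Υ}^{(γ₁;γ₂;γ₃;γ₄)}(x, y)`. -/
def hkMittagLeffler (κ ρ Υ γ₁ γ₂ γ₃ γ₄ x y : ℂ) : ℂ :=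
  ∑' s : ℕ, ∑' r : ℕ, hkTerm κ ρ Υ γ₁ γ₂ γ₃ γ₄ x y s r

/-- The integrand, at the point `q = (t, Ω)`, of the integral operator evaluated at
`p = (X, Y)`. -/
def hkIntegrand (κ ρ Υ ν₁ ν₂ γ₁ γ₂ γ₃ γ₄ : ℂ) (ψ : ℝ × ℝ → ℂ) (p q : ℝ × ℝ) : ℂ :=
  ((p.1 - q.1 : ℝ) : ℂ) ^ (κ - 1) * ((p.2 - q.2 : ℝ) : ℂ) ^ (ρ - 1) *
    hkMittagLeffler κ ρ Υ γ₁ γ₂ γ₃ γ₄ (ν₁ * ((p.1 - q.1 : ℝ) : ℂ)) (ν₂ * ((p.2 - q.2 : ℝ) : ℂ)) *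
    ψ q

/-- The integral operator with the modified bivariate H-K Mittag-Leffler function in the kernel. -/
def hkOperator (A C : ℝ) (κ ρ Υ ν₁ ν₂ γ₁ γ₂ γ₃ γ₄ : ℂ) (ψ : ℝ × ℝ → ℂ) (p : ℝ × ℝ) : ℂ :=
  ∫ w in C..p.2, ∫ t in A..p.1, hkIntegrand κ ρ Υ ν₁ ν₂ γ₁ γ₂ γ₃ γ₄ ψ p (t, w)

/-- The double Riemann-Liouville integral, of order `α` in the first and of order `β` in the second
variable. -/
def doubleRL (A C : ℝ) (α β : ℂ) (g : ℝ × ℝ → ℂ) (p : ℝ × ℝ) : ℂ :=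
  1 / (Complex.Gamma β * Complex.Gamma α) *
    ∫ w in C..p.2, ∫ t in A..p.1,
      ((p.1 - t : ℝ) : ℂ) ^ (α - 1) * ((p.2 - w : ℝ) : ℂ) ^ (β - 1) * g (t, w)

end

/-!
Along the family `γ₃ = (γ₁ + 1) / 2`, `γ₄ = γ₂` the quotients of Pochhammer symbols simplify, and the
kernel becomes a series of products of powers,
`∑ (γ₁/2)_s / s! * (γ₂ + s)_r / r! * (4 ν₁)^s (ν₂ ^ Υ)^r *
  z₁ ^ (κ + s - 1) / Γ(κ + s) * z₂ ^ (ρ + Υ r - 1) / Γ(ρ + Υ r)`.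

Absolute convergence needs `|Γ(ρ + Υ r)|` to grow faster than every geometric sequence also for
complex `Υ`. No asymptotics of `Γ` are used: the quotient of consecutive values is
`Γ(Υ)` divided by the Beta integral `B(ρ + Υ r, Υ)`, and this Beta integral tends to zero by dominated
convergence (`summable_pow_div_Gamma`). The rest of the coefficient grows at most geometrically
(`exists_summable_bound`).

The kernels form a convolution semigroup (`setIntegral_hkKernel_mul_hkKernel_sub`). Termwise, the
Beta integral adds the exponents of two powers, and the coefficients multiply correctly because of
the Chu–Vandermonde identity for `(z)_n / n!`. It is applied first to the inner indices, where the
base points `μ₂ + s` and `γ₂ + s'` add up to `γ₂ + μ₂ + (s + s')`, which depends on `s + s'` only, and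
then to the outer ones (`sum_antidiagonal_hkCoeff`).

Truncating the kernel to `(0, B - A) × (0, D - C)` and the function to the rectangle makes both
integrable on the plane, and on the rectangle the operator is their convolution
(`ae_iteratedIntegral_eq_convolution`). Existence almost everywhere, integrability and the
composition rule are then the corresponding facts for convolutions of integrable functions, the last
one being associativity (`ae_iteratedIntegral_comp`). For vanishing upper parameters the series
reduces to its first term `1 / (Γ(κ) Γ(ρ))`, and the kernel to that of Riemann–Liouville.
-/

section

open Filter Topology Finset

/-! ### Growth of the Gamma function along an arithmetic progression -/

theorem re_add_mul_natCast_pos {ρ Υ : ℂ} (hρ : 0 < ρ.re) (hΥ : 0 < Υ.re) (n : ℕ) :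
    0 < (ρ + Υ * n).re := by
  simp only [Complex.add_re, Complex.mul_re, Complex.natCast_re, Complex.natCast_im]
  nlinarith [mul_nonneg hΥ.le (Nat.cast_nonneg (α := ℝ) n)]

theorem re_add_natCast_pos {κ : ℂ} (hκ : 0 < κ.re) (n : ℕ) : 0 < (κ + n).re := by
  simp only [Complex.add_re, Complex.natCast_re]
  positivity

theorem tendsto_betaIntegral_add_mul_natCast {ρ Υ : ℂ} (hρ : 0 < ρ.re) (hΥ : 0 < Υ.re) :
    Tendsto (fun n : ℕ => Complex.betaIntegral (ρ + Υ * n) Υ) atTop (𝓝 0) := by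
  have key : Tendsto (fun n : ℕ => ∫ x in (0 : ℝ)..1,
      (x : ℂ) ^ (ρ + Υ * n - 1) * (1 - (x : ℂ)) ^ (Υ - 1)) atTop
      (𝓝 (∫ _ in (0 : ℝ)..1, (0 : ℂ))) := by
    refine intervalIntegral.tendsto_integral_filter_of_dominated_convergence
      (fun x : ℝ => ‖(x : ℂ) ^ (ρ - 1) * (1 - (x : ℂ)) ^ (Υ - 1)‖) ?_ ?_
      (Complex.betaIntegral_convergent hρ hΥ).norm ?_
    · exact Eventually.of_forall fun n => (Complex.betaIntegral_convergent
        (re_add_mul_natCast_pos hρ hΥ n) hΥ).def'.aestronglyMeasurable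
    · refine Eventually.of_forall fun n => Eventually.of_forall fun x hx => ?_
      rw [Set.uIoc_of_le zero_le_one] at hx
      rw [norm_mul, norm_mul]
      refine mul_le_mul_of_nonneg_right ?_ (norm_nonneg _)
      rw [Complex.norm_cpow_eq_rpow_re_of_pos hx.1, Complex.norm_cpow_eq_rpow_re_of_pos hx.1]
      refine Real.rpow_le_rpow_of_exponent_ge hx.1 hx.2 ?_
      simp only [Complex.add_re, Complex.sub_re, Complex.mul_re, Complex.natCast_re,
        Complex.natCast_im]
      nlinarith [mul_nonneg hΥ.le (Nat.cast_nonneg (α := ℝ) n)]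
    · -- At the endpoint `x = 1` the powers of `x` do not tend to zero.
      have h1 : ∀ᵐ x : ℝ, x ≠ 1 := by simp [ae_iff]
      filter_upwards [h1] with x hx1 hx
      rw [Set.uIoc_of_le zero_le_one] at hx
      have hx0 : (x : ℂ) ≠ 0 := Complex.ofReal_ne_zero.mpr hx.1.ne'
      have h : Tendsto (fun n : ℕ => (x : ℂ) ^ (ρ - 1) * ((x : ℂ) ^ Υ) ^ n *
          (1 - (x : ℂ)) ^ (Υ - 1)) atTop (𝓝 ((x : ℂ) ^ (ρ - 1) * 0 * (1 - (x : ℂ)) ^ (Υ - 1))) := by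
        refine ((tendsto_pow_atTop_nhds_zero_of_norm_lt_one ?_).const_mul _).mul_const _
        rw [Complex.norm_cpow_eq_rpow_re_of_pos hx.1]
        exact Real.rpow_lt_one hx.1.le (lt_of_le_of_ne hx.2 hx1) hΥ
      rw [mul_zero, zero_mul] at h
      refine h.congr fun n => ?_
      rw [← Complex.cpow_mul_nat, ← Complex.cpow_add _ _ hx0]
      ring_nf
  simpa [Complex.betaIntegral] using key

/-- The reciprocals of the values of `Γ` along the progression decay faster than any geometric
sequence: the quotient of consecutive values is a Beta integral, which tends to zero. -/
theorem summable_pow_div_Gamma {ρ Υ : ℂ} (hρ : 0 < ρ.re) (hΥ : 0 < Υ.re) (w : ℂ) :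
    Summable fun n : ℕ => w ^ n / Complex.Gamma (ρ + Υ * n) := by
  have h := ((tendsto_betaIntegral_add_mul_natCast hρ hΥ).const_mul
    (w / Complex.Gamma Υ)).norm
  rw [mul_zero, norm_zero] at h
  refine summable_of_ratio_norm_eventually_le (r := 1 / 2) (by norm_num) ?_
  filter_upwards [h.eventually_le_const (show (0 : ℝ) < 1 / 2 by norm_num)] with n hn
  have hre := re_add_mul_natCast_pos hρ hΥ n
  have hB := Complex.Gamma_mul_Gamma_eq_betaIntegral hre hΥ
  have e : ρ + Υ * n + Υ = ρ + Υ * ((n + 1 : ℕ) : ℂ) := by push_cast; ring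
  rw [e] at hB
  have hg1 := Complex.Gamma_ne_zero_of_re_pos hre
  have hg2 := Complex.Gamma_ne_zero_of_re_pos hΥ
  have hg3 : Complex.Gamma (ρ + Υ * ((n + 1 : ℕ) : ℂ)) ≠ 0 :=
    fun h0 => mul_ne_zero hg1 hg2 (by rw [hB, h0, zero_mul])
  have hq : w ^ (n + 1) / Complex.Gamma (ρ + Υ * ((n + 1 : ℕ) : ℂ)) =
      w / Complex.Gamma Υ * Complex.betaIntegral (ρ + Υ * n) Υ *
        (w ^ n / Complex.Gamma (ρ + Υ * n)) := by
    field_simp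
    linear_combination w ^ (n + 1) * hB
  rw [hq, norm_mul]
  exact mul_le_mul_of_nonneg_right hn (norm_nonneg _)

/-! ### Pochhammer symbols and the coefficients of the series -/

theorem hkQuotX_family (γ : ℂ) (s : ℕ) :
    hkQuotX γ ((γ + 1) / 2) s = 4 ^ s * poch (γ / 2) s := by
  by_cases h0 : poch ((γ + 1) / 2) s = 0
  · simp [hkQuotX, h0]
  · simp only [hkQuotX, h0, false_and, if_false]
    rw [poch_two_mul, mul_div_cancel_right₀ _ h0]

theorem hkQuotY_family (γ : ℂ) (s r : ℕ) : hkQuotY γ γ s r = poch (γ + s) r := by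
  by_cases h0 : poch γ s = 0
  · simp [hkQuotY, h0]
  · simp only [hkQuotY, h0, false_and, if_false]
    rw [poch_add, mul_div_cancel_left₀ _ h0]

/-- The rising factorial is dominated by that of the integer `k`, so the quotient is dominated by
a binomial coefficient. -/
theorem norm_poch_div_factorial_le {z : ℂ} {k : ℕ} (hz : ‖z‖ ≤ k) (n : ℕ) :
    ‖poch z n / (n.factorial : ℂ)‖ ≤ 2 ^ (k + n) := by
  have h1 : ‖poch z n‖ ≤ (k.ascFactorial n : ℝ) := by
    induction n with
    | zero => simp [poch_zero]
    | succ n ih =>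
      rw [poch_succ, norm_mul, Nat.ascFactorial_succ, Nat.cast_mul, mul_comm]
      refine mul_le_mul ?_ ih (norm_nonneg _) (Nat.cast_nonneg _)
      refine (norm_add_le _ _).trans ?_
      rw [Complex.norm_natCast, Nat.cast_add]
      gcongr
  have h2 : (k.ascFactorial n : ℝ) ≤ n.factorial * 2 ^ (k + n) := by
    rw [Nat.ascFactorial_eq_factorial_mul_choose']
    push_cast
    gcongr
    have : (k + n - 1).choose n ≤ 2 ^ (k + n) :=
      (Nat.choose_le_two_pow _ _).trans (Nat.pow_le_pow_right (by norm_num) (by omega))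
    exact_mod_cast this
  rw [norm_div, Complex.norm_natCast, div_le_iff₀ (by positivity), mul_comm]
  exact h1.trans h2

/-- The Chu–Vandermonde identity for rising factorials. -/
theorem sum_antidiagonal_poch_div_factorial (a b : ℂ) (n : ℕ) :
    ∑ i ∈ antidiagonal n, poch a i.1 / (i.1.factorial : ℂ) * (poch b i.2 / (i.2.factorial : ℂ)) =
      poch (a + b) n / (n.factorial : ℂ) := by
  have step : ∀ (z : ℂ) (n : ℕ), ((n + 1 : ℕ) : ℂ) * (poch z (n + 1) / ((n + 1).factorial : ℂ)) =
      (z + n) * (poch z n / (n.factorial : ℂ)) := by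
    intro z n
    have h1 : ((n + 1 : ℕ) : ℂ) ≠ 0 := Nat.cast_ne_zero.mpr n.succ_ne_zero
    have h2 : (n.factorial : ℂ) ≠ 0 := Nat.cast_ne_zero.mpr n.factorial_ne_zero
    rw [poch_succ, Nat.factorial_succ, Nat.cast_mul]
    field_simp
  induction n with
  | zero => simp [poch_zero]
  | succ n ih =>
    have h1 : ((n + 1 : ℕ) : ℂ) ≠ 0 := Nat.cast_ne_zero.mpr n.succ_ne_zero
    refine mul_left_cancel₀ h1 ?_
    rw [step, ← ih, mul_sum, mul_sum]
    -- Write `n + 1 = i + j` in each summand; both parts reindex to sums over `antidiagonal n`.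
    have split : ∀ i ∈ antidiagonal (n + 1), ((n + 1 : ℕ) : ℂ) *
        (poch a i.1 / (i.1.factorial : ℂ) * (poch b i.2 / (i.2.factorial : ℂ))) =
        (i.1 : ℂ) * (poch a i.1 / (i.1.factorial : ℂ)) * (poch b i.2 / (i.2.factorial : ℂ)) +
        poch a i.1 / (i.1.factorial : ℂ) * ((i.2 : ℂ) * (poch b i.2 / (i.2.factorial : ℂ))) := by
      intro i hi
      rw [← mem_antidiagonal.mp hi, Nat.cast_add]
      ring
    rw [sum_congr rfl split, sum_add_distrib, Finset.Nat.sum_antidiagonal_succ,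
      Finset.Nat.sum_antidiagonal_succ']
    simp only [step, Nat.cast_zero, zero_mul, mul_zero, zero_add]
    rw [← sum_add_distrib]
    refine sum_congr rfl fun i hi => ?_
    rw [← mem_antidiagonal.mp hi, Nat.cast_add]
    ring

/-- The coefficient of `1 / (Γ(κ + s) Γ(ρ + Υ r))`, `n = (s, r)`, in the series of
`E_{κ,ρ,Υ}^{(γ₁;γ₂;(γ₁+1)/2;γ₂)}(x, y)`, with `w` in the place of `y ^ Υ`. -/
noncomputable def hkCoeff (γ₁ γ₂ x w : ℂ) (n : ℕ × ℕ) : ℂ :=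
  poch (γ₁ / 2) n.1 / (n.1.factorial : ℂ) * (poch (γ₂ + n.1) n.2 / (n.2.factorial : ℂ)) *
    (4 * x) ^ n.1 * w ^ n.2

theorem hkTerm_family (κ ρ Υ γ₁ γ₂ x y : ℂ) (n : ℕ × ℕ) :
    hkTerm κ ρ Υ γ₁ γ₂ ((γ₁ + 1) / 2) γ₂ x y n.1 n.2 =
      hkCoeff γ₁ γ₂ x (y ^ Υ) n /
        (Complex.Gamma (κ + n.1) * Complex.Gamma (ρ + Υ * n.2)) := by
  rw [hkTerm, hkQuotX_family, hkQuotY_family, Complex.cpow_mul_nat, hkCoeff, mul_pow]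
  simp only [div_eq_mul_inv, mul_inv]
  ring

theorem sum_antidiagonal_hkCoeff (γ₁ γ₂ μ₁ μ₂ x w : ℂ) (n : ℕ × ℕ) :
    ∑ i ∈ antidiagonal n.1, ∑ j ∈ antidiagonal n.2,
      hkCoeff μ₁ μ₂ x w (i.1, j.1) * hkCoeff γ₁ γ₂ x w (i.2, j.2) =
      hkCoeff (γ₁ + μ₁) (γ₂ + μ₂) x w n := by
  -- For fixed `i` the sum over `j` is a Vandermonde sum whose value depends on `i.1 + i.2` only.
  have inner : ∀ i ∈ antidiagonal n.1, ∑ j ∈ antidiagonal n.2,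
      hkCoeff μ₁ μ₂ x w (i.1, j.1) * hkCoeff γ₁ γ₂ x w (i.2, j.2) =
      poch (μ₁ / 2) i.1 / (i.1.factorial : ℂ) * (poch (γ₁ / 2) i.2 / (i.2.factorial : ℂ)) *
        (poch (γ₂ + μ₂ + n.1) n.2 / (n.2.factorial : ℂ) * (4 * x) ^ n.1 * w ^ n.2) := by
    intro i hi
    have hi' := mem_antidiagonal.mp hi
    have e : γ₂ + μ₂ + n.1 = (μ₂ + i.1) + (γ₂ + i.2) := by rw [← hi']; push_cast; ring
    rw [e, ← sum_antidiagonal_poch_div_factorial, sum_mul, sum_mul, mul_sum]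
    refine sum_congr rfl fun j hj => ?_
    rw [hkCoeff, hkCoeff, ← hi', ← mem_antidiagonal.mp hj, pow_add, pow_add]
    ring
  rw [sum_congr rfl inner, ← sum_mul, sum_antidiagonal_poch_div_factorial, hkCoeff,
    show μ₁ / 2 + γ₁ / 2 = (γ₁ + μ₁) / 2 by ring]
  ring

/-- A summable majorant of the series, uniform on bounded sets of `x` and `w = y ^ Υ`. -/
theorem exists_summable_bound {κ ρ Υ : ℂ} (hκ : 0 < κ.re) (hρ : 0 < ρ.re) (hΥ : 0 < Υ.re)
    (γ₁ γ₂ : ℂ) (X W : ℝ) :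
    ∃ b : ℕ × ℕ → ℝ, Summable b ∧ ∀ x w : ℂ, ‖x‖ ≤ X → ‖w‖ ≤ W → ∀ n : ℕ × ℕ,
      ‖hkCoeff γ₁ γ₂ x w n / (Complex.Gamma (κ + n.1) * Complex.Gamma (ρ + Υ * n.2))‖ ≤ b n := by
  -- `(z)_n / n!` is at most `2 ^ (k + n)` for `‖z‖ ≤ k`. With `z = γ₂ + s` this costs an extra
  -- factor `2 ^ s`, so that the ratios become `2 * 2 * 4 * X = 16 X` in `s` and `2 W` in `r`.
  obtain ⟨k, hk⟩ := exists_nat_ge ‖γ₁ / 2‖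
  obtain ⟨l, hl⟩ := exists_nat_ge ‖γ₂‖
  have h1 := (summable_pow_div_Gamma hκ (Υ := 1) (by simp) ((16 * X : ℝ) : ℂ)).norm
  have h2 := (summable_pow_div_Gamma hρ hΥ ((2 * W : ℝ) : ℂ)).norm
  refine ⟨fun n => 2 ^ (k + l) *
    (‖((16 * X : ℝ) : ℂ) ^ n.1 / Complex.Gamma (κ + 1 * n.1)‖ *
      ‖((2 * W : ℝ) : ℂ) ^ n.2 / Complex.Gamma (ρ + Υ * n.2)‖),
    (h1.mul_of_nonneg h2 (fun _ => norm_nonneg _) fun _ => norm_nonneg _).mul_left _, ?_⟩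
  rintro x w hx hw ⟨s, r⟩
  have hX : 0 ≤ X := (norm_nonneg _).trans hx
  have hW : 0 ≤ W := (norm_nonneg _).trans hw
  have hl' : ‖γ₂ + s‖ ≤ ((l + s : ℕ) : ℝ) := by
    refine (norm_add_le _ _).trans ?_
    rw [Complex.norm_natCast, Nat.cast_add]
    gcongr
  have hc : ‖hkCoeff γ₁ γ₂ x w (s, r)‖ ≤ 2 ^ (k + l) * ((16 * X) ^ s * (2 * W) ^ r) := by
    calc ‖hkCoeff γ₁ γ₂ x w (s, r)‖
        = ‖poch (γ₁ / 2) s / (s.factorial : ℂ)‖ * ‖poch (γ₂ + s) r / (r.factorial : ℂ)‖ *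
          (4 * ‖x‖) ^ s * ‖w‖ ^ r := by
          simp only [hkCoeff, norm_mul, norm_pow, Complex.norm_ofNat]
      _ ≤ 2 ^ (k + s) * 2 ^ (l + s + r) * (4 * X) ^ s * W ^ r := by
          gcongr
          · exact norm_poch_div_factorial_le hk s
          · exact norm_poch_div_factorial_le hl' r
      _ = 2 ^ (k + l) * ((16 * X) ^ s * (2 * W) ^ r) := by
          rw [show (16 : ℝ) * X = 2 * 2 * (4 * X) by ring]
          simp only [mul_pow, pow_add]
          ring
  simp only [norm_div, norm_mul, norm_pow, Complex.norm_real, one_mul]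
  rw [Real.norm_of_nonneg (by positivity : (0 : ℝ) ≤ 16), Real.norm_of_nonneg hX,
    Real.norm_of_nonneg (by positivity : (0 : ℝ) ≤ 2), Real.norm_of_nonneg hW,
    div_mul_div_comm, ← mul_div_assoc]
  gcongr

theorem summable_hkTerm {κ ρ Υ : ℂ} (hκ : 0 < κ.re) (hρ : 0 < ρ.re) (hΥ : 0 < Υ.re)
    (γ₁ γ₂ x y : ℂ) :
    Summable fun n : ℕ × ℕ => hkTerm κ ρ Υ γ₁ γ₂ ((γ₁ + 1) / 2) γ₂ x y n.1 n.2 := by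
  obtain ⟨b, hb, hle⟩ := exists_summable_bound hκ hρ hΥ γ₁ γ₂ ‖x‖ ‖y ^ Υ‖
  refine Summable.of_norm_bounded hb fun n => ?_
  rw [hkTerm_family]
  exact hle _ _ le_rfl le_rfl n

/-! ### The kernel of the operator -/

/-- The product of powers `z₁ ^ (α - 1) z₂ ^ (β - 1)`, the Riemann–Liouville kernel without its
Gamma factors. -/
noncomputable def powKernel (α β : ℂ) (z : ℝ × ℝ) : ℂ :=
  (z.1 : ℂ) ^ (α - 1) * (z.2 : ℂ) ^ (β - 1)

/-- The kernel of the integral operator, which is `(X, Y), (t, Ω) ↦ hkKernel (X - t, Y - Ω)`, along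
the family `γ₃ = (γ₁ + 1) / 2`, `γ₄ = γ₂`. -/
noncomputable def hkKernel (κ ρ Υ ν₁ ν₂ γ₁ γ₂ : ℂ) (z : ℝ × ℝ) : ℂ :=
  powKernel κ ρ z * hkMittagLeffler κ ρ Υ γ₁ γ₂ ((γ₁ + 1) / 2) γ₂ (ν₁ * z.1) (ν₂ * z.2)

/-- The general term of the expansion of the kernel in products of powers, `n = (s, r)`. -/
noncomputable def hkKernelTerm (κ ρ Υ ν₁ ν₂ γ₁ γ₂ : ℂ) (n : ℕ × ℕ) (z : ℝ × ℝ) : ℂ :=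
  hkCoeff γ₁ γ₂ ν₁ (ν₂ ^ Υ) n * (powKernel (κ + n.1) (ρ + Υ * n.2) z /
    (Complex.Gamma (κ + n.1) * Complex.Gamma (ρ + Υ * n.2)))

/-- A positive real factor does not change the argument, so the principal power is
multiplicative. -/
theorem mul_ofReal_cpow (x : ℂ) {r : ℝ} (hr : 0 < r) (z : ℂ) :
    (x * (r : ℂ)) ^ z = x ^ z * (r : ℂ) ^ z := by
  have hr' : (r : ℂ) ≠ 0 := Complex.ofReal_ne_zero.mpr hr.ne'
  rcases eq_or_ne x 0 with rfl | hx
  · rcases eq_or_ne z 0 with rfl | hz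
    · simp
    · simp [Complex.zero_cpow hz]
  · rw [Complex.cpow_def_of_ne_zero (mul_ne_zero hx hr'), Complex.cpow_def_of_ne_zero hx,
      Complex.cpow_def_of_ne_zero hr', Complex.log_mul_ofReal r hr x hx, ← Complex.exp_add,
      Complex.ofReal_log hr.le]
    ring_nf

/-- Since the second coordinate is positive, the principal power `(ν₂ z₂) ^ (Υ r)` splits as
`(ν₂ ^ Υ) ^ r * z₂ ^ (Υ r)`, so the expansion of the kernel is the series of the Mittag-Leffler
function, term by term. -/
theorem hkKernelTerm_eq (κ ρ Υ ν₁ ν₂ γ₁ γ₂ : ℂ) (n : ℕ × ℕ) {z : ℝ × ℝ} (h1 : 0 < z.1)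
    (h2 : 0 < z.2) :
    hkKernelTerm κ ρ Υ ν₁ ν₂ γ₁ γ₂ n z = powKernel κ ρ z *
      (hkCoeff γ₁ γ₂ (ν₁ * z.1) ((ν₂ * z.2) ^ Υ) n /
        (Complex.Gamma (κ + n.1) * Complex.Gamma (ρ + Υ * n.2))) := by
  have h1' : (z.1 : ℂ) ≠ 0 := Complex.ofReal_ne_zero.mpr h1.ne'
  have h2' : (z.2 : ℂ) ≠ 0 := Complex.ofReal_ne_zero.mpr h2.ne'
  have e1 : κ + n.1 - 1 = κ - 1 + n.1 := by ring
  have e2 : ρ + Υ * n.2 - 1 = ρ - 1 + Υ * n.2 := by ring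
  rw [hkKernelTerm, powKernel, powKernel, hkCoeff, hkCoeff, mul_ofReal_cpow _ h2, e1, e2,
    Complex.cpow_add _ _ h1', Complex.cpow_add _ _ h2', Complex.cpow_natCast, Complex.cpow_mul_nat,
    mul_pow, mul_pow, mul_pow, mul_pow]
  ring

/-- On a bounded part of the open quadrant the expansion of the kernel is dominated, term by term,
by a convergent numerical series times the leading power. -/
theorem exists_bound_hkKernelTerm {κ ρ Υ : ℂ} (hκ : 0 < κ.re) (hρ : 0 < ρ.re) (hΥ : 0 < Υ.re)
    (ν₁ ν₂ γ₁ γ₂ : ℂ) (a b : ℝ) :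
    ∃ c : ℕ × ℕ → ℝ, Summable c ∧ (∀ n, 0 ≤ c n) ∧
      ∀ z ∈ Set.Ioo 0 a ×ˢ Set.Ioo 0 b, ∀ n : ℕ × ℕ,
        ‖hkKernelTerm κ ρ Υ ν₁ ν₂ γ₁ γ₂ n z‖ ≤ c n * ‖powKernel κ ρ z‖ := by
  obtain ⟨c, hc, hle⟩ := exists_summable_bound hκ hρ hΥ γ₁ γ₂ (‖ν₁‖ * |a|)
    (‖ν₂ ^ Υ‖ * |b| ^ Υ.re)
  refine ⟨fun n => |c n|, hc.abs, fun n => abs_nonneg _, fun z hz n => ?_⟩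
  obtain ⟨⟨h1, h1a⟩, h2, h2b⟩ := hz
  rw [hkKernelTerm_eq _ _ _ _ _ _ _ _ h1 h2, norm_mul, mul_comm]
  refine mul_le_mul_of_nonneg_right ((hle _ _ ?_ ?_ n).trans (le_abs_self _)) (norm_nonneg _)
  · rw [norm_mul, Complex.norm_real, Real.norm_of_nonneg h1.le]
    gcongr
    exact h1a.le.trans (le_abs_self a)
  · rw [mul_ofReal_cpow _ h2, norm_mul, Complex.norm_cpow_eq_rpow_re_of_pos h2]
    gcongr
    exact h2b.le.trans (le_abs_self b)

theorem hasSum_hkKernelTerm {κ ρ Υ : ℂ} (hκ : 0 < κ.re) (hρ : 0 < ρ.re) (hΥ : 0 < Υ.re)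
    (ν₁ ν₂ γ₁ γ₂ : ℂ) {z : ℝ × ℝ} (h1 : 0 < z.1) (h2 : 0 < z.2) :
    HasSum (fun n => hkKernelTerm κ ρ Υ ν₁ ν₂ γ₁ γ₂ n z) (hkKernel κ ρ Υ ν₁ ν₂ γ₁ γ₂ z) := by
  have hs := summable_hkTerm hκ hρ hΥ γ₁ γ₂ (ν₁ * z.1) (ν₂ * z.2)
  have h := hs.hasSum.mul_left (powKernel κ ρ z)
  rw [hs.tsum_prod] at h
  refine h.congr_fun ?_
  intro n
  rw [hkKernelTerm_eq _ _ _ _ _ _ _ _ h1 h2, hkTerm_family]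

theorem integrableOn_powKernel {α β : ℂ} (hα : 0 < α.re) (hβ : 0 < β.re) (a b : ℝ) :
    IntegrableOn (powKernel α β) (Set.Ioo 0 a ×ˢ Set.Ioo 0 b) := by
  have h : ∀ {r : ℂ} (_ : 0 < r.re) (a : ℝ),
      Integrable (fun x : ℝ => (x : ℂ) ^ (r - 1)) (volume.restrict (Set.Ioo 0 a)) := fun hr a =>
    (intervalIntegral.intervalIntegrable_cpow' (a := 0) (b := a) (by simpa using hr)).1.mono_set
      Set.Ioo_subset_Ioc_self
  rw [IntegrableOn, Measure.volume_eq_prod, ← Measure.prod_restrict]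
  exact (h hα a).mul_prod (h hβ b)

theorem aestronglyMeasurable_hkKernelTerm {κ ρ Υ : ℂ} (hκ : 0 < κ.re) (hρ : 0 < ρ.re)
    (hΥ : 0 < Υ.re) (ν₁ ν₂ γ₁ γ₂ : ℂ) (a b : ℝ) (n : ℕ × ℕ) :
    AEStronglyMeasurable (hkKernelTerm κ ρ Υ ν₁ ν₂ γ₁ γ₂ n)
      (volume.restrict (Set.Ioo 0 a ×ˢ Set.Ioo 0 b)) := by
  exact ((integrableOn_powKernel (re_add_natCast_pos hκ n.1)
    (re_add_mul_natCast_pos hρ hΥ n.2) a b).div_const _).const_mul _ |>.aestronglyMeasurable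

theorem integrableOn_hkKernel {κ ρ Υ : ℂ} (hκ : 0 < κ.re) (hρ : 0 < ρ.re) (hΥ : 0 < Υ.re)
    (ν₁ ν₂ γ₁ γ₂ : ℂ) (a b : ℝ) :
    IntegrableOn (hkKernel κ ρ Υ ν₁ ν₂ γ₁ γ₂) (Set.Ioo 0 a ×ˢ Set.Ioo 0 b) := by
  have hR : MeasurableSet (Set.Ioo (0 : ℝ) a ×ˢ Set.Ioo (0 : ℝ) b) :=
    measurableSet_Ioo.prod measurableSet_Ioo
  obtain ⟨c, hc, -, hle⟩ := exists_bound_hkKernelTerm hκ hρ hΥ ν₁ ν₂ γ₁ γ₂ a b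
  refine Integrable.mono' ((integrableOn_powKernel hκ hρ a b).norm.const_mul (∑' n, c n)) ?_ ?_
  · refine aestronglyMeasurable_of_tendsto_ae (atTop : Filter (Finset (ℕ × ℕ)))
      (f := fun t z => ∑ n ∈ t, hkKernelTerm κ ρ Υ ν₁ ν₂ γ₁ γ₂ n z) (fun t => ?_) ?_
    · exact Finset.aestronglyMeasurable_fun_sum t fun n _ =>
        aestronglyMeasurable_hkKernelTerm hκ hρ hΥ ν₁ ν₂ γ₁ γ₂ a b n
    · filter_upwards [ae_restrict_mem hR] with z hz
      exact hasSum_hkKernelTerm hκ hρ hΥ ν₁ ν₂ γ₁ γ₂ hz.1.1 hz.2.1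
  · filter_upwards [ae_restrict_mem hR] with z hz
    rw [← (hasSum_hkKernelTerm hκ hρ hΥ ν₁ ν₂ γ₁ γ₂ hz.1.1 hz.2.1).tsum_eq, ← tsum_mul_right]
    exact tsum_of_norm_bounded (hc.mul_right _).hasSum fun n => hle z hz n

/-! ### Convolution of two kernels -/

/-- Euler's Beta integral over `(0, u)`. -/
theorem setIntegral_cpow_mul_cpow {s t : ℂ} (hs : 0 < s.re) (ht : 0 < t.re) {u : ℝ} (hu : 0 < u) :
    ∫ x in Set.Ioo 0 u, (x : ℂ) ^ (s - 1) * ((u - x : ℝ) : ℂ) ^ (t - 1) =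
      Complex.Gamma s * Complex.Gamma t * ((u : ℂ) ^ (s + t - 1) / Complex.Gamma (s + t)) := by
  have hg : Complex.Gamma (s + t) ≠ 0 :=
    Complex.Gamma_ne_zero_of_re_pos (by simpa using add_pos hs ht)
  have h := Complex.betaIntegral_scaled s t hu
  rw [intervalIntegral.integral_of_le hu.le, integral_Ioc_eq_integral_Ioo] at h
  simp only [Complex.ofReal_sub]
  rw [h, Complex.Gamma_mul_Gamma_eq_betaIntegral hs ht]
  field_simp

theorem integrableOn_cpow_mul_cpow {s t : ℂ} (hs : 0 < s.re) (ht : 0 < t.re) {u : ℝ}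
    (hu : 0 < u) :
    IntegrableOn (fun x : ℝ => (x : ℂ) ^ (s - 1) * ((u - x : ℝ) : ℂ) ^ (t - 1)) (Set.Ioo 0 u) := by
  -- The Bochner integral of a function that is not integrable would be zero.
  by_contra hn
  have h := setIntegral_cpow_mul_cpow hs ht hu
  rw [integral_undef hn] at h
  have hu' : (u : ℂ) ≠ 0 := Complex.ofReal_ne_zero.mpr hu.ne'
  have hst : 0 < (s + t).re := by simpa using add_pos hs ht
  exact mul_ne_zero (mul_ne_zero (Complex.Gamma_ne_zero_of_re_pos hs)
    (Complex.Gamma_ne_zero_of_re_pos ht)) (div_ne_zero (by simp [Complex.cpow_eq_zero_iff, hu'])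
    (Complex.Gamma_ne_zero_of_re_pos hst)) h.symm

theorem powKernel_mul_powKernel_sub (α β α' β' : ℂ) (z q : ℝ × ℝ) :
    powKernel α β q * powKernel α' β' (z - q) =
      ((q.1 : ℂ) ^ (α - 1) * ((z.1 - q.1 : ℝ) : ℂ) ^ (α' - 1)) *
        ((q.2 : ℂ) ^ (β - 1) * ((z.2 - q.2 : ℝ) : ℂ) ^ (β' - 1)) := by
  simp only [powKernel, Prod.fst_sub, Prod.snd_sub]
  ring

theorem integrableOn_powKernel_mul_powKernel_sub {α β α' β' : ℂ} (hα : 0 < α.re) (hβ : 0 < β.re)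
    (hα' : 0 < α'.re) (hβ' : 0 < β'.re) {z : ℝ × ℝ} (h1 : 0 < z.1) (h2 : 0 < z.2) :
    IntegrableOn (fun q => powKernel α β q * powKernel α' β' (z - q))
      (Set.Ioo 0 z.1 ×ˢ Set.Ioo 0 z.2) := by
  simp only [powKernel_mul_powKernel_sub]
  rw [IntegrableOn, Measure.volume_eq_prod, ← Measure.prod_restrict]
  exact Integrable.mul_prod (integrableOn_cpow_mul_cpow hα hα' h1)
    (integrableOn_cpow_mul_cpow hβ hβ' h2)

theorem setIntegral_powKernel_mul_powKernel_sub {α β α' β' : ℂ} (hα : 0 < α.re) (hβ : 0 < β.re)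
    (hα' : 0 < α'.re) (hβ' : 0 < β'.re) {z : ℝ × ℝ} (h1 : 0 < z.1) (h2 : 0 < z.2) :
    ∫ q in Set.Ioo 0 z.1 ×ˢ Set.Ioo 0 z.2,
      powKernel α β q / (Complex.Gamma α * Complex.Gamma β) *
        (powKernel α' β' (z - q) / (Complex.Gamma α' * Complex.Gamma β')) =
      powKernel (α + α') (β + β') z / (Complex.Gamma (α + α') * Complex.Gamma (β + β')) := by
  simp only [div_mul_div_comm, powKernel_mul_powKernel_sub, integral_div]
  rw [Measure.volume_eq_prod, setIntegral_prod_mul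
      (fun x : ℝ => (x : ℂ) ^ (α - 1) * ((z.1 - x : ℝ) : ℂ) ^ (α' - 1))
      (fun y : ℝ => (y : ℂ) ^ (β - 1) * ((z.2 - y : ℝ) : ℂ) ^ (β' - 1)),
    setIntegral_cpow_mul_cpow hα hα' h1, setIntegral_cpow_mul_cpow hβ hβ' h2, powKernel]
  have g1 := Complex.Gamma_ne_zero_of_re_pos hα
  have g2 := Complex.Gamma_ne_zero_of_re_pos hβ
  have g3 := Complex.Gamma_ne_zero_of_re_pos hα'
  have g4 := Complex.Gamma_ne_zero_of_re_pos hβ'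
  field_simp

/-- Regrouping of an unconditionally convergent double series over `ℕ × ℕ` along `n + m`. -/
theorem HasSum.sum_antidiagonal_prod {f : (ℕ × ℕ) × (ℕ × ℕ) → ℂ} {S : ℂ} (hf : HasSum f S) :
    HasSum (fun n : ℕ × ℕ => ∑ i ∈ antidiagonal n.1, ∑ j ∈ antidiagonal n.2,
      f ((i.1, j.1), (i.2, j.2))) S := by
  refine (hf.tsum_fiberwise fun x => x.1 + x.2).congr_fun fun n => ?_
  -- The pairs with a given sum form a finite set, a product of two antidiagonals up to the order
  -- of the factors.
  have hset : (fun x : (ℕ × ℕ) × (ℕ × ℕ) => x.1 + x.2) ⁻¹' {n} =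
      ((antidiagonal n.1 ×ˢ antidiagonal n.2).map
        (Equiv.prodProdProdComm ℕ ℕ ℕ ℕ).toEmbedding : Finset ((ℕ × ℕ) × (ℕ × ℕ))) := by
    ext ⟨⟨a, b⟩, c, d⟩
    simp only [Set.mem_preimage, Set.mem_singleton_iff, Prod.ext_iff, Finset.coe_map,
      Set.mem_image, Finset.mem_coe, Finset.mem_product,
      HasAntidiagonal.mem_antidiagonal, Prod.exists]
    constructor
    · rintro ⟨h1, h2⟩
      exact ⟨a, c, b, d, ⟨h1, h2⟩, ⟨rfl, rfl⟩, rfl, rfl⟩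
    · rintro ⟨a', c', b', d', ⟨h1, h2⟩, h⟩
      obtain ⟨⟨rfl, rfl⟩, rfl, rfl⟩ : (a' = a ∧ b' = b) ∧ c' = c ∧ d' = d := by simpa using h
      exact ⟨h1, h2⟩
  rw [hset, Finset.tsum_subtype', Finset.sum_map, Finset.sum_product]
  rfl

/-- The kernels form a semigroup under convolution on the quadrant. -/
theorem setIntegral_hkKernel_mul_hkKernel_sub {κ ρ σ η Υ : ℂ} (hκ : 0 < κ.re) (hρ : 0 < ρ.re)
    (hσ : 0 < σ.re) (hη : 0 < η.re) (hΥ : 0 < Υ.re) (ν₁ ν₂ γ₁ γ₂ μ₁ μ₂ : ℂ) {z : ℝ × ℝ}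
    (h1 : 0 < z.1) (h2 : 0 < z.2) :
    ∫ q in Set.Ioo 0 z.1 ×ˢ Set.Ioo 0 z.2,
      hkKernel κ ρ Υ ν₁ ν₂ γ₁ γ₂ (z - q) * hkKernel σ η Υ ν₁ ν₂ μ₁ μ₂ q =
      hkKernel (κ + σ) (ρ + η) Υ ν₁ ν₂ (γ₁ + μ₁) (γ₂ + μ₂) z := by
  have hR : MeasurableSet (Set.Ioo (0 : ℝ) z.1 ×ˢ Set.Ioo (0 : ℝ) z.2) :=
    measurableSet_Ioo.prod measurableSet_Ioo
  have hsub : ∀ q ∈ Set.Ioo 0 z.1 ×ˢ Set.Ioo 0 z.2, z - q ∈ Set.Ioo 0 z.1 ×ˢ Set.Ioo 0 z.2 := by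
    rintro q ⟨⟨a, b⟩, c, d⟩
    refine ⟨⟨?_, ?_⟩, ?_, ?_⟩ <;> simp only [Prod.fst_sub, Prod.snd_sub] <;> linarith
  obtain ⟨c, hc, hc0, hcle⟩ := exists_bound_hkKernelTerm hκ hρ hΥ ν₁ ν₂ γ₁ γ₂ z.1 z.2
  obtain ⟨d, hd, hd0, hdle⟩ := exists_bound_hkKernelTerm hσ hη hΥ ν₁ ν₂ μ₁ μ₂ z.1 z.2
  have hdc : Summable fun i : (ℕ × ℕ) × (ℕ × ℕ) => d i.1 * c i.2 := hd.mul_of_nonneg hc hd0 hc0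
  set F : (ℕ × ℕ) × (ℕ × ℕ) → ℝ × ℝ → ℂ := fun i q =>
    hkKernelTerm σ η Υ ν₁ ν₂ μ₁ μ₂ i.1 q * hkKernelTerm κ ρ Υ ν₁ ν₂ γ₁ γ₂ i.2 (z - q) with hF
  have hFle : ∀ i, ∀ q ∈ Set.Ioo 0 z.1 ×ˢ Set.Ioo 0 z.2,
      ‖F i q‖ ≤ d i.1 * c i.2 * ‖powKernel σ η q * powKernel κ ρ (z - q)‖ := by
    intro i q hq
    rw [hF, norm_mul, norm_mul]
    refine (mul_le_mul (hdle q hq i.1) (hcle _ (hsub q hq) i.2) (norm_nonneg _)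
      (mul_nonneg (hd0 _) (norm_nonneg _))).trans (le_of_eq ?_)
    ring
  have hFeq : ∀ i q, F i q = hkCoeff μ₁ μ₂ ν₁ (ν₂ ^ Υ) i.1 * hkCoeff γ₁ γ₂ ν₁ (ν₂ ^ Υ) i.2 *
      (powKernel (σ + i.1.1) (η + Υ * i.1.2) q /
          (Complex.Gamma (σ + i.1.1) * Complex.Gamma (η + Υ * i.1.2)) *
        (powKernel (κ + i.2.1) (ρ + Υ * i.2.2) (z - q) /
          (Complex.Gamma (κ + i.2.1) * Complex.Gamma (ρ + Υ * i.2.2)))) := by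
    intro i q
    simp only [hF, hkKernelTerm]
    ring
  have hFmeas : ∀ i, AEStronglyMeasurable (F i)
      (volume.restrict (Set.Ioo 0 z.1 ×ˢ Set.Ioo 0 z.2)) := by
    intro i
    have := ((integrableOn_powKernel_mul_powKernel_sub
      (re_add_natCast_pos hσ i.1.1) (re_add_mul_natCast_pos hη hΥ i.1.2)
      (re_add_natCast_pos hκ i.2.1) (re_add_mul_natCast_pos hρ hΥ i.2.2) h1 h2).div_const
        (Complex.Gamma (σ + i.1.1) * Complex.Gamma (η + Υ * i.1.2) *
          (Complex.Gamma (κ + i.2.1) * Complex.Gamma (ρ + Υ * i.2.2)))).const_mul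
        (hkCoeff μ₁ μ₂ ν₁ (ν₂ ^ Υ) i.1 * hkCoeff γ₁ γ₂ ν₁ (ν₂ ^ Υ) i.2)
    refine this.aestronglyMeasurable.congr (Eventually.of_forall fun q => ?_)
    simp only [hFeq, div_mul_div_comm]
  have hsum : HasSum (fun i => ∫ q in Set.Ioo 0 z.1 ×ˢ Set.Ioo 0 z.2, F i q)
      (∫ q in Set.Ioo 0 z.1 ×ˢ Set.Ioo 0 z.2,
        hkKernel κ ρ Υ ν₁ ν₂ γ₁ γ₂ (z - q) * hkKernel σ η Υ ν₁ ν₂ μ₁ μ₂ q) := by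
    refine hasSum_integral_of_dominated_convergence
      (fun i q => d i.1 * c i.2 * ‖powKernel σ η q * powKernel κ ρ (z - q)‖) hFmeas
      (fun i => (ae_restrict_mem hR).mono fun q hq => hFle i q hq)
      (Eventually.of_forall fun q => hdc.mul_right _) ?_
      ((ae_restrict_mem hR).mono fun q hq => ?_)
    · simp only [tsum_mul_right]
      exact (integrableOn_powKernel_mul_powKernel_sub hσ hη hκ hρ h1 h2).norm.const_mul _
    · have hq' := hsub q hq
      have hs : Summable fun i => F i q :=
        Summable.of_norm_bounded (hdc.mul_right _) fun i => hFle i q hq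
      have hm := HasSum.mul (hasSum_hkKernelTerm hσ hη hΥ ν₁ ν₂ μ₁ μ₂ hq.1.1 hq.2.1)
        (hasSum_hkKernelTerm hκ hρ hΥ ν₁ ν₂ γ₁ γ₂ hq'.1.1 hq'.2.1) hs
      rwa [mul_comm (hkKernel σ η Υ ν₁ ν₂ μ₁ μ₂ q)] at hm
  have hσκ : 0 < (κ + σ).re := by simpa using add_pos hκ hσ
  have hηρ : 0 < (ρ + η).re := by simpa using add_pos hρ hη
  refine hsum.sum_antidiagonal_prod.unique
    ((hasSum_hkKernelTerm hσκ hηρ hΥ ν₁ ν₂ (γ₁ + μ₁) (γ₂ + μ₂) h1 h2).congr_fun fun n => ?_)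
  rw [hkKernelTerm, ← sum_antidiagonal_hkCoeff, sum_mul]
  refine sum_congr rfl fun i hi => ?_
  rw [sum_mul]
  refine sum_congr rfl fun j hj => ?_
  simp only [hFeq]
  rw [integral_const_mul, setIntegral_powKernel_mul_powKernel_sub (re_add_natCast_pos hσ _)
    (re_add_mul_natCast_pos hη hΥ _) (re_add_natCast_pos hκ _) (re_add_mul_natCast_pos hρ hΥ _)
    h1 h2, ← mem_antidiagonal.mp hi, ← mem_antidiagonal.mp hj]
  push_cast
  ring_nf

/-! ### Integral operators with a difference kernel as convolutions on the plane -/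

open scoped Convolution
open ContinuousLinearMap (mul)

/-- On the rectangle, cutting off the kernel outside `(0, B - A) × (0, D - C)` and the function
outside the rectangle leaves exactly the integration region `(A, X) × (C, Y)`. -/
theorem indicator_mul_indicator_sub {A B C D : ℝ} (K ψ : ℝ × ℝ → ℂ) {p : ℝ × ℝ}
    (hp : p ∈ Set.Ioo A B ×ˢ Set.Ioo C D) (q : ℝ × ℝ) :
    (Set.Ioo A B ×ˢ Set.Ioo C D).indicator ψ q *
        (Set.Ioo 0 (B - A) ×ˢ Set.Ioo 0 (D - C)).indicator K (p - q) =
      (Set.Ioo A p.1 ×ˢ Set.Ioo C p.2).indicator (fun q => K (p - q) * ψ q) q := by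
  obtain ⟨⟨hp1, hp2⟩, hp3, hp4⟩ := hp
  by_cases hq : q ∈ Set.Ioo A p.1 ×ˢ Set.Ioo C p.2
  · obtain ⟨⟨h1, h2⟩, h3, h4⟩ := id hq
    have hQ : q ∈ Set.Ioo A B ×ˢ Set.Ioo C D := ⟨⟨h1, h2.trans hp2⟩, h3, h4.trans hp4⟩
    have hR : p - q ∈ Set.Ioo 0 (B - A) ×ˢ Set.Ioo 0 (D - C) := by
      refine ⟨⟨?_, ?_⟩, ?_, ?_⟩ <;> simp only [Prod.fst_sub, Prod.snd_sub] <;> linarith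
    rw [Set.indicator_of_mem hq, Set.indicator_of_mem hQ, Set.indicator_of_mem hR, mul_comm]
  · rw [Set.indicator_of_notMem hq]
    by_cases hQ : q ∈ Set.Ioo A B ×ˢ Set.Ioo C D
    · rw [Set.indicator_of_notMem (a := p - q), mul_zero]
      rintro ⟨⟨h1, -⟩, h3, -⟩
      simp only [Prod.fst_sub, Prod.snd_sub, sub_pos] at h1 h3
      exact hq ⟨⟨hQ.1.1, h1⟩, hQ.2.1, h3⟩
    · rw [Set.indicator_of_notMem hQ, zero_mul]

theorem convolution_indicator_eq_setIntegral {A B C D : ℝ} (K ψ : ℝ × ℝ → ℂ) {p : ℝ × ℝ}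
    (hp : p ∈ Set.Ioo A B ×ˢ Set.Ioo C D) :
    ((Set.Ioo A B ×ˢ Set.Ioo C D).indicator ψ ⋆[mul ℂ ℂ, volume]
        (Set.Ioo 0 (B - A) ×ˢ Set.Ioo 0 (D - C)).indicator K) p =
      ∫ q in Set.Ioo A p.1 ×ˢ Set.Ioo C p.2, K (p - q) * ψ q := by
  rw [convolution_def, ← integral_indicator (measurableSet_Ioo.prod measurableSet_Ioo)]
  exact integral_congr_ae (Eventually.of_forall fun q => indicator_mul_indicator_sub K ψ hp q)

theorem ae_integrableOn_kernel_mul {A B C D : ℝ} {K ψ : ℝ × ℝ → ℂ}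
    (hK : IntegrableOn K (Set.Ioo 0 (B - A) ×ˢ Set.Ioo 0 (D - C)))
    (hψ : IntegrableOn ψ (Set.Ioo A B ×ˢ Set.Ioo C D)) :
    ∀ᵐ p ∂(volume.restrict (Set.Ioo A B ×ˢ Set.Ioo C D)),
      IntegrableOn (fun q => K (p - q) * ψ q) (Set.Ioo A p.1 ×ˢ Set.Ioo C p.2) := by
  have hK' := hK.integrable_indicator (measurableSet_Ioo.prod measurableSet_Ioo)
  have hψ' := hψ.integrable_indicator (measurableSet_Ioo.prod measurableSet_Ioo)
  filter_upwards [ae_restrict_mem (measurableSet_Ioo.prod measurableSet_Ioo),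
    ae_restrict_of_ae (hψ'.ae_convolution_exists (mul ℂ ℂ) hK')] with p hp hex
  rw [← integrable_indicator_iff (measurableSet_Ioo.prod measurableSet_Ioo)]
  exact hex.congr (Eventually.of_forall fun q => indicator_mul_indicator_sub K ψ hp q)

theorem ae_iteratedIntegral_eq_convolution {A B C D : ℝ} {K ψ : ℝ × ℝ → ℂ}
    (hK : IntegrableOn K (Set.Ioo 0 (B - A) ×ˢ Set.Ioo 0 (D - C)))
    (hψ : IntegrableOn ψ (Set.Ioo A B ×ˢ Set.Ioo C D)) :
    ∀ᵐ p ∂(volume.restrict (Set.Ioo A B ×ˢ Set.Ioo C D)),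
      ∫ w in C..p.2, ∫ t in A..p.1, K (p - (t, w)) * ψ (t, w) =
        ((Set.Ioo A B ×ˢ Set.Ioo C D).indicator ψ ⋆[mul ℂ ℂ, volume]
          (Set.Ioo 0 (B - A) ×ˢ Set.Ioo 0 (D - C)).indicator K) p := by
  filter_upwards [ae_restrict_mem (measurableSet_Ioo.prod measurableSet_Ioo),
    ae_integrableOn_kernel_mul hK hψ] with p hp hint
  rw [convolution_indicator_eq_setIntegral K ψ hp, intervalIntegral.integral_of_le hp.2.1.le,
    integral_Ioc_eq_integral_Ioo]
  simp only [intervalIntegral.integral_of_le hp.1.1.le, integral_Ioc_eq_integral_Ioo]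
  rw [IntegrableOn, Measure.volume_eq_prod, ← Measure.prod_restrict] at hint
  rw [Measure.volume_eq_prod, ← Measure.prod_restrict, integral_prod_symm _ hint]

/-- The truncated kernel lives on the open quadrant, so the convolution vanishes to the left of the
rectangle and below it. -/
theorem convolution_indicator_eq_zero {A B C D : ℝ} (K ψ : ℝ × ℝ → ℂ) {p : ℝ × ℝ}
    (hp : p.1 ≤ A ∨ p.2 ≤ C) :
    ((Set.Ioo A B ×ˢ Set.Ioo C D).indicator ψ ⋆[mul ℂ ℂ, volume]
        (Set.Ioo 0 (B - A) ×ˢ Set.Ioo 0 (D - C)).indicator K) p = 0 := by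
  rw [convolution_def]
  refine integral_eq_zero_of_ae (Eventually.of_forall fun q => ?_)
  simp only [ContinuousLinearMap.mul_apply', Pi.zero_apply]
  by_cases hQ : q ∈ Set.Ioo A B ×ˢ Set.Ioo C D
  · rw [Set.indicator_of_notMem (a := p - q), mul_zero]
    rintro ⟨⟨h1, -⟩, h3, -⟩
    simp only [Prod.fst_sub, Prod.snd_sub, sub_pos] at h1 h3
    rcases hp with h | h
    · exact absurd (hQ.1.1.trans h1) (not_lt.mpr h)
    · exact absurd (hQ.2.1.trans h3) (not_lt.mpr h)
  · rw [Set.indicator_of_notMem hQ, zero_mul]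

/-- Associativity for three integrable functions, at almost every point. -/
theorem ae_convolution_assoc {f g k : ℝ × ℝ → ℂ} (hf : Integrable f) (hg : Integrable g)
    (hk : Integrable k) :
    ∀ᵐ p, ((f ⋆[mul ℂ ℂ, volume] g) ⋆[mul ℂ ℂ, volume] k) p =
      (f ⋆[mul ℂ ℂ, volume] (g ⋆[mul ℂ ℂ, volume] k)) p := by
  have hgk : Integrable ((fun x => ‖g x‖) ⋆[mul ℝ ℝ, volume] fun x => ‖k x‖) :=
    hg.norm.integrable_convolution (mul ℝ ℝ) hk.norm
  filter_upwards [hf.norm.ae_convolution_exists (mul ℝ ℝ) hgk] with p hp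
  exact convolution_assoc _ _ _ _ (fun x y z => mul_assoc x y z) hf.aestronglyMeasurable
    hg.aestronglyMeasurable hk.aestronglyMeasurable (hf.ae_convolution_exists _ hg)
    (hg.norm.ae_convolution_exists _ hk.norm) hp

/-- If the convolution of the kernels `K₂` and `K₁` on the quadrant is `K₃`, then the operators
with these kernels satisfy the same composition rule on integrable functions. -/
theorem ae_iteratedIntegral_comp {A B C D : ℝ} {K₁ K₂ K₃ ψ φ : ℝ × ℝ → ℂ}
    (hK₁ : IntegrableOn K₁ (Set.Ioo 0 (B - A) ×ˢ Set.Ioo 0 (D - C)))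
    (hK₂ : IntegrableOn K₂ (Set.Ioo 0 (B - A) ×ˢ Set.Ioo 0 (D - C)))
    (hK₃ : IntegrableOn K₃ (Set.Ioo 0 (B - A) ×ˢ Set.Ioo 0 (D - C)))
    (hψ : IntegrableOn ψ (Set.Ioo A B ×ˢ Set.Ioo C D))
    (hK : ∀ z : ℝ × ℝ, 0 < z.1 → 0 < z.2 →
      ∫ q in Set.Ioo 0 z.1 ×ˢ Set.Ioo 0 z.2, K₁ (z - q) * K₂ q = K₃ z)
    (hφ : ∀ p, φ p = ∫ w in C..p.2, ∫ t in A..p.1, K₂ (p - (t, w)) * ψ (t, w)) :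
    ∀ᵐ p ∂(volume.restrict (Set.Ioo A B ×ˢ Set.Ioo C D)),
      ∫ w in C..p.2, ∫ t in A..p.1, K₁ (p - (t, w)) * φ (t, w) =
        ∫ w in C..p.2, ∫ t in A..p.1, K₃ (p - (t, w)) * ψ (t, w) := by
  set Q := Set.Ioo A B ×ˢ Set.Ioo C D with hQdef
  set R := Set.Ioo 0 (B - A) ×ˢ Set.Ioo 0 (D - C) with hRdef
  have hQ : MeasurableSet Q := measurableSet_Ioo.prod measurableSet_Ioo
  have hR : MeasurableSet R := measurableSet_Ioo.prod measurableSet_Ioo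
  have hψ' := hψ.integrable_indicator hQ
  have hK₁' := hK₁.integrable_indicator hR
  have hK₂' := hK₂.integrable_indicator hR
  have hφae : ∀ᵐ p ∂(volume.restrict Q),
      φ p = (Q.indicator ψ ⋆[mul ℂ ℂ, volume] R.indicator K₂) p := by
    filter_upwards [ae_iteratedIntegral_eq_convolution hK₂ hψ] with p hp
    rw [hφ, hp]
  have hφint : IntegrableOn φ Q :=
    ((hψ'.integrable_convolution (mul ℂ ℂ) hK₂').integrableOn).congr
      (hφae.mono fun p hp => hp.symm)
  filter_upwards [ae_restrict_mem hQ, ae_iteratedIntegral_eq_convolution hK₁ hφint,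
    ae_iteratedIntegral_eq_convolution hK₃ hψ,
    ae_restrict_of_ae (ae_convolution_assoc hψ' hK₂' hK₁')] with p hp h1 h3 hassoc
  rw [h1, h3, ← hQdef, ← hRdef]
  have left : (Q.indicator φ ⋆[mul ℂ ℂ, volume] R.indicator K₁) p =
      ((Q.indicator ψ ⋆[mul ℂ ℂ, volume] R.indicator K₂) ⋆[mul ℂ ℂ, volume]
        R.indicator K₁) p := by
    have hcongr := (ae_restrict_iff' hQ).mp hφae
    refine integral_congr_ae (hcongr.mono fun q hq => ?_)
    simp only [ContinuousLinearMap.mul_apply']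
    by_cases hqQ : q ∈ Q
    · simp only [Set.indicator_of_mem hqQ, hq hqQ]
    · rw [Set.indicator_of_notMem hqQ]
      by_cases hqR : p - q ∈ R
      -- A point `q` outside the rectangle with `q < p` lies to the left of it or below it.
      · obtain ⟨⟨h1, -⟩, h3, -⟩ := hqR
        simp only [Prod.fst_sub, Prod.snd_sub, sub_pos] at h1 h3
        have hlt : q.1 ≤ A ∨ q.2 ≤ C := by
          by_contra! hcon
          exact hqQ ⟨⟨hcon.1, h1.trans hp.1.2⟩, hcon.2, h3.trans hp.2.2⟩
        rw [convolution_indicator_eq_zero K₂ ψ hlt]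
      · simp only [Set.indicator_of_notMem hqR, mul_zero]
  have right : (Q.indicator ψ ⋆[mul ℂ ℂ, volume] (R.indicator K₂ ⋆[mul ℂ ℂ, volume]
      R.indicator K₁)) p = (Q.indicator ψ ⋆[mul ℂ ℂ, volume] R.indicator K₃) p := by
    refine integral_congr_ae (Eventually.of_forall fun q => ?_)
    by_cases hqQ : q ∈ Q
    · have hconv : (R.indicator K₂ ⋆[mul ℂ ℂ, volume] R.indicator K₁) (p - q) =
          R.indicator K₃ (p - q) := by
        by_cases hqR : p - q ∈ R
        · have := convolution_indicator_eq_setIntegral (A := 0) (B := B - A) (C := 0)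
            (D := D - C) K₁ K₂ hqR
          rw [sub_zero, sub_zero, hK _ hqR.1.1 hqR.2.1] at this
          rw [Set.indicator_of_mem hqR, ← this]
        · have hle : (p - q).1 ≤ 0 ∨ (p - q).2 ≤ 0 := by
            by_contra! hcon
            refine hqR ⟨⟨hcon.1, ?_⟩, hcon.2, ?_⟩ <;> simp only [Prod.fst_sub, Prod.snd_sub]
            · linarith [hp.1.2, hqQ.1.1]
            · linarith [hp.2.2, hqQ.2.1]
          have := convolution_indicator_eq_zero (A := 0) (B := B - A) (C := 0) (D := D - C)
            K₁ K₂ hle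
          rw [sub_zero, sub_zero] at this
          rw [Set.indicator_of_notMem hqR, ← this]
      simp only [hconv]
    · simp only [ContinuousLinearMap.mul_apply', Set.indicator_of_notMem hqQ, zero_mul]
  rw [left, hassoc, right]

/-! ### The Hermite–Konhauser operators -/

theorem hkIntegrand_eq_hkKernel_mul (κ ρ Υ ν₁ ν₂ γ₁ γ₂ : ℂ) (ψ : ℝ × ℝ → ℂ) (p q : ℝ × ℝ) :
    hkIntegrand κ ρ Υ ν₁ ν₂ γ₁ γ₂ ((γ₁ + 1) / 2) γ₂ ψ p q =
      hkKernel κ ρ Υ ν₁ ν₂ γ₁ γ₂ (p - q) * ψ q := by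
  simp only [hkIntegrand, hkKernel, powKernel, Prod.fst_sub, Prod.snd_sub]

theorem hkOperator_eq_iteratedIntegral (A C : ℝ) (κ ρ Υ ν₁ ν₂ γ₁ γ₂ : ℂ) (ψ : ℝ × ℝ → ℂ)
    (p : ℝ × ℝ) :
    hkOperator A C κ ρ Υ ν₁ ν₂ γ₁ γ₂ ((γ₁ + 1) / 2) γ₂ ψ p =
      ∫ w in C..p.2, ∫ t in A..p.1, hkKernel κ ρ Υ ν₁ ν₂ γ₁ γ₂ (p - (t, w)) * ψ (t, w) := by
  simp only [hkOperator, hkIntegrand_eq_hkKernel_mul]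

theorem ae_integrableOn_hkIntegrand {A B C D : ℝ} {κ ρ Υ : ℂ} (hκ : 0 < κ.re) (hρ : 0 < ρ.re)
    (hΥ : 0 < Υ.re) (ν₁ ν₂ γ₁ γ₂ : ℂ) {ψ : ℝ × ℝ → ℂ}
    (hψ : IntegrableOn ψ (Set.Ioo A B ×ˢ Set.Ioo C D)) :
    ∀ᵐ p ∂(volume.restrict (Set.Ioo A B ×ˢ Set.Ioo C D)),
      IntegrableOn (hkIntegrand κ ρ Υ ν₁ ν₂ γ₁ γ₂ ((γ₁ + 1) / 2) γ₂ ψ p)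
        (Set.Ioo A p.1 ×ˢ Set.Ioo C p.2) := by
  filter_upwards [ae_integrableOn_kernel_mul
    (integrableOn_hkKernel hκ hρ hΥ ν₁ ν₂ γ₁ γ₂ (B - A) (D - C)) hψ] with p hp
  simpa only [← hkIntegrand_eq_hkKernel_mul] using hp

theorem hkOperator_comp {A B C D : ℝ} {κ ρ σ η Υ : ℂ} (hκ : 0 < κ.re) (hρ : 0 < ρ.re)
    (hσ : 0 < σ.re) (hη : 0 < η.re) (hΥ : 0 < Υ.re) (ν₁ ν₂ γ₁ γ₂ μ₁ μ₂ : ℂ) {ψ : ℝ × ℝ → ℂ}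
    (hψ : IntegrableOn ψ (Set.Ioo A B ×ˢ Set.Ioo C D)) :
    ∀ᵐ p ∂(volume.restrict (Set.Ioo A B ×ˢ Set.Ioo C D)),
      hkOperator A C κ ρ Υ ν₁ ν₂ γ₁ γ₂ ((γ₁ + 1) / 2) γ₂
          (hkOperator A C σ η Υ ν₁ ν₂ μ₁ μ₂ ((μ₁ + 1) / 2) μ₂ ψ) p =
        hkOperator A C (κ + σ) (ρ + η) Υ ν₁ ν₂
          (γ₁ + μ₁) (γ₂ + μ₂) ((γ₁ + μ₁ + 1) / 2) (γ₂ + μ₂) ψ p := by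
  have hK₃ := integrableOn_hkKernel (κ := κ + σ) (ρ := ρ + η) (by simpa using add_pos hκ hσ)
    (by simpa using add_pos hρ hη) hΥ ν₁ ν₂ (γ₁ + μ₁) (γ₂ + μ₂) (B - A) (D - C)
  simp only [hkOperator_eq_iteratedIntegral _ _ κ ρ,
    hkOperator_eq_iteratedIntegral _ _ (κ + σ) (ρ + η)]
  exact ae_iteratedIntegral_comp (integrableOn_hkKernel hκ hρ hΥ ν₁ ν₂ γ₁ γ₂ _ _)
    (integrableOn_hkKernel hσ hη hΥ ν₁ ν₂ μ₁ μ₂ _ _) hK₃ hψ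
    (fun _ h1 h2 => setIntegral_hkKernel_mul_hkKernel_sub hκ hρ hσ hη hΥ ν₁ ν₂ γ₁ γ₂ μ₁ μ₂ h1 h2)
    (hkOperator_eq_iteratedIntegral _ _ σ η Υ ν₁ ν₂ μ₁ μ₂ ψ)

theorem integrableOn_hkOperator {A B C D : ℝ} {κ ρ Υ : ℂ} (hκ : 0 < κ.re) (hρ : 0 < ρ.re)
    (hΥ : 0 < Υ.re) (ν₁ ν₂ γ₁ γ₂ : ℂ) {ψ : ℝ × ℝ → ℂ}
    (hψ : IntegrableOn ψ (Set.Ioo A B ×ˢ Set.Ioo C D)) :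
    IntegrableOn (hkOperator A C κ ρ Υ ν₁ ν₂ γ₁ γ₂ ((γ₁ + 1) / 2) γ₂ ψ)
      (Set.Ioo A B ×ˢ Set.Ioo C D) := by
  have hK := integrableOn_hkKernel hκ hρ hΥ ν₁ ν₂ γ₁ γ₂ (B - A) (D - C)
  have hψ' := hψ.integrable_indicator (measurableSet_Ioo.prod measurableSet_Ioo)
  exact ((hψ'.integrable_convolution (mul ℂ ℂ) (hK.integrable_indicator
      (measurableSet_Ioo.prod measurableSet_Ioo))).integrableOn).congr
    ((ae_iteratedIntegral_eq_convolution hK hψ).mono fun p hp =>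
      (hkOperator_eq_iteratedIntegral _ _ _ _ _ _ _ _ _ _ _ |>.trans hp).symm)

theorem poch_zero_left {n : ℕ} (hn : n ≠ 0) : poch 0 n = 0 := by
  simp [poch, hn]

/-- For vanishing upper parameters only the term `s = r = 0` of the series survives. -/
theorem hkMittagLeffler_zero (κ ρ Υ x y : ℂ) :
    hkMittagLeffler κ ρ Υ 0 0 (1 / 2) 0 x y = 1 / (Complex.Gamma κ * Complex.Gamma ρ) := by
  have hterm : ∀ s r : ℕ, hkTerm κ ρ Υ 0 0 (1 / 2) 0 x y s r =
      hkCoeff 0 0 x (y ^ Υ) (s, r) /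
        (Complex.Gamma (κ + s) * Complex.Gamma (ρ + Υ * r)) := by
    intro s r
    have h := hkTerm_family κ ρ Υ 0 0 x y (s, r)
    rwa [zero_add] at h
  have hs : ∀ s : ℕ, s ≠ 0 → ∑' r : ℕ, hkTerm κ ρ Υ 0 0 (1 / 2) 0 x y s r = 0 := by
    intro s hs
    simp only [hterm, hkCoeff, zero_div, poch_zero_left hs, zero_mul, tsum_zero]
  have hr : ∀ r : ℕ, r ≠ 0 → hkTerm κ ρ Υ 0 0 (1 / 2) 0 x y 0 r = 0 := by
    intro r hr
    simp only [hterm, hkCoeff, Nat.cast_zero, add_zero, zero_div, poch_zero_left hr, mul_zero,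
      zero_mul]
  rw [hkMittagLeffler, tsum_eq_single 0 hs, tsum_eq_single 0 hr, hterm]
  simp [hkCoeff, poch_zero]

/-- By `hkMittagLeffler_zero` the two iterated integrals have the same integrand up to the constant
factor, so the identity holds at every point and for every function. -/
theorem hkOperator_zero_eq_doubleRL (A C : ℝ) (α β Υ ν₁ ν₂ : ℂ) (ψ : ℝ × ℝ → ℂ) (p : ℝ × ℝ) :
    hkOperator A C α β Υ ν₁ ν₂ 0 0 (1 / 2) 0 ψ p = doubleRL A C α β ψ p := by
  rw [hkOperator, doubleRL, ← intervalIntegral.integral_const_mul]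
  refine intervalIntegral.integral_congr fun w _ => ?_
  rw [← intervalIntegral.integral_const_mul]
  refine intervalIntegral.integral_congr fun t _ => ?_
  simp only [hkIntegrand, hkMittagLeffler_zero]
  ring

end

theorem mainTheorem3
    (A B C D : ℝ) (κ ρ σ η Υ ν₁ ν₂ γ₁ γ₂ μ₁ μ₂ : ℂ)
    (hκ : 0 < κ.re) (hρ : 0 < ρ.re) (hσ : 0 < σ.re) (hη : 0 < η.re) (hΥ : 0 < Υ.re)
    (ψ : ℝ × ℝ → ℂ) (hψ : IntegrableOn ψ (Set.Ioo A B ×ˢ Set.Ioo C D)) :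
    -- the series defining the kernel converges absolutely, everywhere
    (∀ x y : ℂ, Summable fun n : ℕ × ℕ =>
      hkTerm κ ρ Υ γ₁ γ₂ ((γ₁ + 1) / 2) γ₂ x y n.1 n.2) ∧
    -- the operator is defined by absolutely convergent integrals and preserves summability
    (∀ᵐ p ∂(volume.restrict (Set.Ioo A B ×ˢ Set.Ioo C D)),
      IntegrableOn (hkIntegrand κ ρ Υ ν₁ ν₂ γ₁ γ₂ ((γ₁ + 1) / 2) γ₂ ψ p)
        (Set.Ioo A p.1 ×ˢ Set.Ioo C p.2)) ∧
    IntegrableOn (hkOperator A C κ ρ Υ ν₁ ν₂ γ₁ γ₂ ((γ₁ + 1) / 2) γ₂ ψ)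
      (Set.Ioo A B ×ˢ Set.Ioo C D) ∧
    -- the semigroup property
    (∀ᵐ p ∂(volume.restrict (Set.Ioo A B ×ˢ Set.Ioo C D)),
      hkOperator A C κ ρ Υ ν₁ ν₂ γ₁ γ₂ ((γ₁ + 1) / 2) γ₂
          (hkOperator A C σ η Υ ν₁ ν₂ μ₁ μ₂ ((μ₁ + 1) / 2) μ₂ ψ) p =
        hkOperator A C (κ + σ) (ρ + η) Υ ν₁ ν₂
          (γ₁ + μ₁) (γ₂ + μ₂) ((γ₁ + μ₁ + 1) / 2) (γ₂ + μ₂) ψ p) ∧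
    -- the case of opposite parameters
    (∀ᵐ p ∂(volume.restrict (Set.Ioo A B ×ˢ Set.Ioo C D)),
      hkOperator A C κ ρ Υ ν₁ ν₂ γ₁ γ₂ ((γ₁ + 1) / 2) γ₂
          (hkOperator A C σ η Υ ν₁ ν₂ (-γ₁) (-γ₂) ((-γ₁ + 1) / 2) (-γ₂) ψ) p =
        hkOperator A C (κ + σ) (ρ + η) Υ ν₁ ν₂ 0 0 (1 / 2) 0 ψ p ∧
      hkOperator A C (κ + σ) (ρ + η) Υ ν₁ ν₂ 0 0 (1 / 2) 0 ψ p =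
        doubleRL A C (κ + σ) (ρ + η) ψ p) := by
  refine ⟨fun x y => summable_hkTerm hκ hρ hΥ γ₁ γ₂ x y,
    ae_integrableOn_hkIntegrand hκ hρ hΥ ν₁ ν₂ γ₁ γ₂ hψ,
    integrableOn_hkOperator hκ hρ hΥ ν₁ ν₂ γ₁ γ₂ hψ,
    hkOperator_comp hκ hρ hσ hη hΥ ν₁ ν₂ γ₁ γ₂ μ₁ μ₂ hψ, ?_⟩
  filter_upwards [hkOperator_comp hκ hρ hσ hη hΥ ν₁ ν₂ γ₁ γ₂ (-γ₁) (-γ₂) hψ] with p hp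
  refine ⟨?_, hkOperator_zero_eq_doubleRL A C (κ + σ) (ρ + η) Υ ν₁ ν₂ ψ p⟩
  rw [hp, add_neg_cancel, add_neg_cancel, zero_add]
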